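/- Let $s\mapsto(\xi(s),\eta(s))$ be the natural (unit-speed) parametrization, extended $\ell$-periodically to $\mathbb R$, of a $C^\infty$ simple closed curve of length $\ell>0$ that bounds a compact strictly convex region of the plane. A point mass slides on this curve without friction while the curve is rotated in a vertical plane by the angle $\varphi(t)$. The kinetic energy is $$\tfrac12\left(\dot s^2+\dot\varphi^2(\xi^2+\eta^2)+2\dot\varphi\dot s(\xi\eta'-\eta\xi')\right),$$ and the potential energy, in a gravity field that oscillates in time, is $-(1+g(\lambda t))(\xi\sin\varphi+\eta\cos\varphi)$. The equation of motion is $$\ddot s+\ddot\varphi\,(\xi\eta'-\eta\xi')-\dot\varphi^2(\xi\xi'+\eta\eta')-(1+g(\lambda t))(\xi'\sin\varphi+\eta'\cos\varphi)=0,\qquad(\ast)$$ where $\xi,\eta,\xi',\eta'$ are taken at $s=s(t)$. For a given $\varphi$ let $s_1,s_2:\mathbb R\to\mathbb R$ be the continuous functions, unique up to adding one common integer multiple of $\ell$, such that for all $t$ $$\xi'(s_1(t))\sin\varphi(t)+\eta'(s_1(t))\cos\varphi(t)=-1,\qquad \xi'(s_2(t))\sin\varphi(t)+\eta'(s_2(t))\cos\varphi(t)=1,$$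 $$s_1(t)<s_2(t)<s_1(t)+\ell .$$ **Theorem 3.9.** Let $T>0$ and let $g:\mathbb R\to\mathbb R$ be $C^\infty$ and $T$-periodic with $\int_0^Tg(t)\,dt=0$. Then there exists $c>0$ such that for every $C^\infty$ $T$-periodic function $\varphi:\mathbb R\to\mathbb R$ with $|\dot\varphi(t)|<c$ and $|\ddot\varphi(t)|<c$ for all $t$ there exists $\lambda_0$ such that for every integer $\lambda\ge\lambda_0$ equation $(\ast)$ has a $C^\infty$ $T$-periodic solution $s:\mathbb R\to\mathbb R$ with $s_1(t)<s(t)<s_2(t)$ for all $t\in\mathbb R$. -/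

import Mathlib

open scoped ContDiff

/-- `s ↦ (ξ s, η s)` is the natural (unit speed) parametrization, periodically extended to `ℝ`, of a
smooth simple closed curve of length `ℓ` that is strictly convex: it bounds a compact strictly convex
region of the plane. Both orientations are allowed, and the curvature may vanish at some points. -/
structure IsStrictlyConvexClosedCurve (ξ η : ℝ → ℝ) (ℓ : ℝ) : Prop where
  length_pos : 0 < ℓ
  smooth_fst : ContDiff ℝ ∞ ξ
  smooth_snd : ContDiff ℝ ∞ η
  periodic_fst : Function.Periodic ξ ℓ
  periodic_snd : Function.Periodic η ℓ
  unit_speed : ∀ s, deriv ξ s ^ 2 + deriv η s ^ 2 = 1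
  simple : Set.InjOn (fun s => (ξ s, η s)) (Set.Ico 0 ℓ)
  strictly_convex : ∃ K : Set (ℝ × ℝ), IsCompact K ∧ StrictConvex ℝ K ∧
    frontier K = Set.range (fun s => (ξ s, η s))

/-- The derivative with respect to `s` of the vertical coordinate `ξ sin a + η cos a` of the point
with parameter `s`, when the curve is turned by the angle `a`. -/
noncomputable def verticalSlope (ξ η : ℝ → ℝ) (a s : ℝ) : ℝ :=
  deriv ξ s * Real.sin a + deriv η s * Real.cos a

/-- `s₁` and `s₂` are continuous functions of time that mark the two points of the rotating curve where
the tangent line is vertical, with slope `-1` at `s₁` and `1` at `s₂`; `s₂` is the first such parameter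
after `s₁`. For a given `φ` the pair is unique up to adding one common multiple of `ℓ`. -/
structure AreVerticalTangentPoints (ξ η : ℝ → ℝ) (ℓ : ℝ) (φ s₁ s₂ : ℝ → ℝ) : Prop where
  continuous_left : Continuous s₁
  continuous_right : Continuous s₂
  slope_left : ∀ t, verticalSlope ξ η (φ t) (s₁ t) = -1
  slope_right : ∀ t, verticalSlope ξ η (φ t) (s₂ t) = 1
  left_lt_right : ∀ t, s₁ t < s₂ t
  right_lt : ∀ t, s₂ t < s₁ t + ℓ

/-- `s` is a smooth solution, on the whole time axis, of Lagrange's equation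
for the kinetic energy `(s'² + φ'² (ξ² + η²) + 2 φ' s' (ξ η' - η ξ')) / 2` and the potential energy
`-(1 + g (lam * t)) (ξ sin φ + η cos φ)`. -/
def IsRotatingCurveSolution (ξ η φ g : ℝ → ℝ) (lam : ℝ) (s : ℝ → ℝ) : Prop :=
  ContDiff ℝ ∞ s ∧ ∀ t,
    deriv (deriv s) t
      + deriv (deriv φ) t * (ξ (s t) * deriv η (s t) - η (s t) * deriv ξ (s t))
      - deriv φ t ^ 2 * (ξ (s t) * deriv ξ (s t) + η (s t) * deriv η (s t))
      - (1 + g (lam * t)) * verticalSlope ξ η (φ t) (s t) = 0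

/-!
The equation of motion has the form `s'' = f(t, s)` with `f` periodic in `t`, Lipschitz in `s` and
independent of the velocity, so a periodic lower solution `α` (`α'' ≥ f(t, α)`) below a periodic upper
solution `β` (`β'' ≤ f(t, β)`) enclose a periodic solution. For small `φ'`, `φ''` the force is
`(1 + g(λ t)) V` up to a small error, where `V` is the vertical slope: it is directed towards `s₁` near
`s₁` and towards `s₂` near `s₂`, so barriers of this kind exist as soon as the oscillating factor `g`
can be averaged out.

*Barriers.* Since `φ` is periodic, a small bound on `φ'` keeps `φ` close to `φ 0` for all times. Hence
constants `a < b` can be chosen between `s₁` and `s₂` at time `0` with `V` close to `-1/2` at `a` and to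
`1/2` at `b` for all times, and the continuous functions `s₁`, `s₂` never cross the nearby levels
`-3/4`, `3/4` of the slope (`exists_barrier_points`). With `G'' = g`, `G` periodic (here `∫ g = 0` is
used), the function `α(t) = a + λ⁻² G(λ t) V(φ t, a)` satisfies `α'' - f(t, α) = -V(φ t, a)` up to the
small error and `O(1/λ)`; it is a lower solution for large `λ`, and the same construction at `b` gives
an upper solution (`exists_approximate_equilibrium`). As `λ` is an integer, both are `T`-periodic.

*Lower and upper solutions.* For `k` large, `k² x - f(t, x)` is nondecreasing in `x`, and
`-u'' + k² u = h` has a periodic solution that depends monotonically on `h` (`periodicGreen`). The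
iteration `-xₙ₊₁'' + k² xₙ₊₁ = k² xₙ - f(t, xₙ)` from `x₀ = α` is then nondecreasing and bounded by `β`,
and its limit solves the equation (`exists_periodic_solution_between`).
-/

open Filter Topology Set MeasureTheory

/-! ### Periodic solutions of first order linear equations -/

/-- The `T`-periodic solution `v` of `v' + k v = h`, for a continuous `T`-periodic `h` and `k ≠ 0`. It is
written as an integral over a single period; `k` may be negative. -/
noncomputable def periodicResolvent (T k : ℝ) (h : ℝ → ℝ) (t : ℝ) : ℝ :=
  (1 - Real.exp (-(k * T)))⁻¹ * ∫ r in (0 : ℝ)..T, Real.exp (-(k * r)) * h (t - r)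

section Resolvent

variable {T k : ℝ} {h h₁ h₂ : ℝ → ℝ}

theorem one_sub_exp_ne_zero (hT : 0 < T) (hk : k ≠ 0) : 1 - Real.exp (-(k * T)) ≠ 0 := by
  intro h0
  have h1 : Real.exp (-(k * T)) = 1 := by linarith
  rw [Real.exp_eq_one_iff] at h1
  have : k * T ≠ 0 := mul_ne_zero hk hT.ne'
  exact this (by linarith)

theorem one_sub_exp_inv_pos (hT : 0 < T) (hk : 0 < k) :
    0 < (1 - Real.exp (-(k * T)))⁻¹ := by
  apply inv_pos.2
  have : Real.exp (-(k * T)) < 1 := Real.exp_lt_one_iff.2 (by nlinarith [mul_pos hk hT])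
  linarith

theorem one_sub_exp_inv_neg (hT : 0 < T) (hk : k < 0) :
    (1 - Real.exp (-(k * T)))⁻¹ < 0 := by
  apply inv_lt_zero.2
  have : 1 < Real.exp (-(k * T)) := Real.one_lt_exp_iff.2
    (by nlinarith [mul_pos_of_neg_of_neg hk (neg_lt_zero.2 hT)])
  linarith

theorem periodic_periodicResolvent (hp : Function.Periodic h T) :
    Function.Periodic (periodicResolvent T k h) T := by
  intro t
  unfold periodicResolvent
  congr 1
  refine intervalIntegral.integral_congr fun r _ => ?_
  have : h (t + T - r) = h (t - r) := by rw [← hp (t - r)]; congr 1; ring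
  simp only [this]

theorem hasDerivAt_periodicResolvent (hT : 0 < T) (hk : k ≠ 0) (hc : Continuous h)
    (hp : Function.Periodic h T) (t : ℝ) :
    HasDerivAt (periodicResolvent T k h) (h t - k * periodicResolvent T k h t) t := by
  have hne := one_sub_exp_ne_zero hT hk
  have hcont : Continuous fun τ => Real.exp (k * τ) * h τ := by fun_prop
  -- the substitution `τ = t - r` moves the dependence on `t` to the end points
  have hform : periodicResolvent T k h = fun t => (1 - Real.exp (-(k * T)))⁻¹ *
      (Real.exp (-(k * t)) * ((∫ τ in (0 : ℝ)..t, Real.exp (k * τ) * h τ)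
        - ∫ τ in (0 : ℝ)..(t - T), Real.exp (k * τ) * h τ)) := by
    funext t
    unfold periodicResolvent
    congr 1
    rw [intervalIntegral.integral_interval_sub_left (hcont.intervalIntegrable _ _)
      (hcont.intervalIntegrable _ _), ← intervalIntegral.integral_const_mul]
    have := intervalIntegral.integral_comp_sub_left
      (a := 0) (b := T) (fun τ => Real.exp (-(k * t)) * (Real.exp (k * τ) * h τ)) t
    rw [sub_zero] at this
    rw [← this]
    refine intervalIntegral.integral_congr fun r _ => ?_
    rw [← mul_assoc, ← Real.exp_add]
    congr 2
    ring
  have hI : ∀ x, HasDerivAt (fun t => ∫ τ in (0 : ℝ)..t, Real.exp (k * τ) * h τ)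
      (Real.exp (k * x) * h x) x := fun x => hcont.integral_hasStrictDerivAt 0 x |>.hasDerivAt
  have hI2 : HasDerivAt (fun t => ∫ τ in (0 : ℝ)..(t - T), Real.exp (k * τ) * h τ)
      (Real.exp (k * (t - T)) * h (t - T)) t := by
    exact ((hI (t - T)).comp t ((hasDerivAt_id t).sub_const T)).congr_deriv (mul_one _)
  have hE : HasDerivAt (fun t => Real.exp (-(k * t))) (Real.exp (-(k * t)) * (-(k * 1))) t :=
    (((hasDerivAt_id t).const_mul k).neg).exp
  have hmain := (hE.mul ((hI t).sub hI2)).const_mul (1 - Real.exp (-(k * T)))⁻¹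
  rw [hform]
  refine hmain.congr_deriv ?_
  have e1 : Real.exp (-(k * t)) * Real.exp (k * t) = 1 := by
    rw [← Real.exp_add]; simp
  have e2 : Real.exp (-(k * t)) * Real.exp (k * (t - T)) = Real.exp (-(k * T)) := by
    rw [← Real.exp_add]; congr 1; ring
  have e3 : h (t - T) = h t := hp.sub_eq t
  simp only [Pi.sub_apply]
  rw [e3]
  have e4 : (1 - Real.exp (-(k * T)))⁻¹ * (1 - Real.exp (-(k * T))) = 1 := inv_mul_cancel₀ hne
  linear_combination (1 - Real.exp (-(k * T)))⁻¹ * h t * e1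
    - (1 - Real.exp (-(k * T)))⁻¹ * h t * e2 + h t * e4

theorem continuous_periodicResolvent (hT : 0 < T) (hk : k ≠ 0) (hc : Continuous h)
    (hp : Function.Periodic h T) : Continuous (periodicResolvent T k h) :=
  continuous_iff_continuousAt.2 fun t =>
    (hasDerivAt_periodicResolvent hT hk hc hp t).continuousAt

/-- The resolvent is a left inverse of `w ↦ w' + k w` on `T`-periodic functions. -/
theorem periodicResolvent_deriv_add {w w' : ℝ → ℝ} (hT : 0 < T) (hk : k ≠ 0)
    (hw : ∀ t, HasDerivAt w (w' t) t) (hc : Continuous w') (hp : Function.Periodic w T) :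
    periodicResolvent T k (fun t => w' t + k * w t) = w := by
  have hwc : Continuous w := continuous_iff_continuousAt.2 fun t => (hw t).continuousAt
  funext t
  unfold periodicResolvent
  have hd : ∀ r ∈ uIcc 0 T, HasDerivAt (fun r => -(Real.exp (-(k * r)) * w (t - r)))
      (Real.exp (-(k * r)) * (w' (t - r) + k * w (t - r))) r := by
    intro r _
    have h1 : HasDerivAt (fun r => Real.exp (-(k * r))) (Real.exp (-(k * r)) * (-(k * 1))) r :=
      (((hasDerivAt_id r).const_mul k).neg).exp
    have h2 : HasDerivAt (fun r => w (t - r)) (w' (t - r) * (-1)) r :=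
      (hw (t - r)).comp r ((hasDerivAt_id r).const_sub t)
    refine (h1.mul h2).neg.congr_deriv ?_
    ring
  rw [intervalIntegral.integral_eq_sub_of_hasDerivAt hd
    (Continuous.intervalIntegrable (by fun_prop) _ _)]
  have e3 : w (t - T) = w t := hp.sub_eq t
  simp only [e3, mul_zero, neg_zero, Real.exp_zero, sub_zero]
  have e4 := inv_mul_cancel₀ (one_sub_exp_ne_zero hT hk)
  linear_combination w t * e4

theorem integral_exp_mul_mono (hT : 0 < T) (hc₁ : Continuous h₁) (hc₂ : Continuous h₂)
    (hle : ∀ t, h₁ t ≤ h₂ t) (t : ℝ) :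
    ∫ r in (0 : ℝ)..T, Real.exp (-(k * r)) * h₁ (t - r) ≤
      ∫ r in (0 : ℝ)..T, Real.exp (-(k * r)) * h₂ (t - r) :=
  intervalIntegral.integral_mono_on hT.le (Continuous.intervalIntegrable (by fun_prop) _ _)
    (Continuous.intervalIntegrable (by fun_prop) _ _)
    fun r _ => mul_le_mul_of_nonneg_left (hle _) (Real.exp_pos _).le

theorem periodicResolvent_mono (hT : 0 < T) (hk : 0 < k) (hc₁ : Continuous h₁)
    (hc₂ : Continuous h₂) (hle : ∀ t, h₁ t ≤ h₂ t) (t : ℝ) :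
    periodicResolvent T k h₁ t ≤ periodicResolvent T k h₂ t :=
  mul_le_mul_of_nonneg_left (integral_exp_mul_mono hT hc₁ hc₂ hle t)
    (one_sub_exp_inv_pos hT hk).le

theorem periodicResolvent_anti (hT : 0 < T) (hk : k < 0) (hc₁ : Continuous h₁)
    (hc₂ : Continuous h₂) (hle : ∀ t, h₁ t ≤ h₂ t) (t : ℝ) :
    periodicResolvent T k h₂ t ≤ periodicResolvent T k h₁ t :=
  mul_le_mul_of_nonpos_left (integral_exp_mul_mono hT hc₁ hc₂ hle t)
    (one_sub_exp_inv_neg hT hk).le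

theorem tendsto_periodicResolvent {H : ℕ → ℝ → ℝ} {C : ℝ} (hc : ∀ n, Continuous (H n))
    (hC : ∀ n t, |H n t| ≤ C) (hlim : ∀ t, Tendsto (fun n => H n t) atTop (𝓝 (h t))) (t : ℝ) :
    Tendsto (fun n => periodicResolvent T k (H n) t) atTop (𝓝 (periodicResolvent T k h t)) := by
  unfold periodicResolvent
  refine Tendsto.const_mul _ ?_
  refine intervalIntegral.tendsto_integral_filter_of_dominated_convergence
    (fun r => Real.exp (-(k * r)) * C) ?_ ?_ ?_ ?_
  · refine Eventually.of_forall fun n => Continuous.aestronglyMeasurable ?_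
    have := hc n
    fun_prop
  · refine Eventually.of_forall fun n => Eventually.of_forall fun r _ => ?_
    rw [Real.norm_eq_abs, abs_mul, Real.abs_exp]
    exact mul_le_mul_of_nonneg_left (hC n _) (Real.exp_pos _).le
  · exact Continuous.intervalIntegrable (by fun_prop) _ _
  · exact Eventually.of_forall fun r _ => (hlim _).const_mul _

end Resolvent

/-! ### Periodic solutions of `-u'' + k² u = h` -/

/-- The `T`-periodic solution `u` of `-u'' + k ^ 2 * u = h`, for a continuous `T`-periodic `h` and
`k > 0`. It is obtained from the factorization `-D² + k² = (D + k) (-D + k)`. -/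
noncomputable def periodicGreen (T k : ℝ) (h : ℝ → ℝ) (t : ℝ) : ℝ :=
  -periodicResolvent T (-k) (periodicResolvent T k h) t

section Green

variable {T k : ℝ} {h h₁ h₂ : ℝ → ℝ}

theorem periodic_periodicGreen (hp : Function.Periodic h T) :
    Function.Periodic (periodicGreen T k h) T := fun t => by
  unfold periodicGreen
  rw [periodic_periodicResolvent (periodic_periodicResolvent hp) t]

theorem hasDerivAt_periodicGreen (hT : 0 < T) (hk : 0 < k) (hc : Continuous h)
    (hp : Function.Periodic h T) (t : ℝ) :
    HasDerivAt (periodicGreen T k h)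
      (k * periodicGreen T k h t - periodicResolvent T k h t) t := by
  refine (hasDerivAt_periodicResolvent hT (neg_ne_zero.2 hk.ne')
    (continuous_periodicResolvent hT hk.ne' hc hp) (periodic_periodicResolvent hp) t).neg.congr_deriv ?_
  unfold periodicGreen
  ring

theorem continuous_periodicGreen (hT : 0 < T) (hk : 0 < k) (hc : Continuous h)
    (hp : Function.Periodic h T) : Continuous (periodicGreen T k h) :=
  continuous_iff_continuousAt.2 fun t => (hasDerivAt_periodicGreen hT hk hc hp t).continuousAt

theorem periodicGreen_mono (hT : 0 < T) (hk : 0 < k) (hc₁ : Continuous h₁)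
    (hp₁ : Function.Periodic h₁ T) (hc₂ : Continuous h₂) (hp₂ : Function.Periodic h₂ T)
    (hle : ∀ t, h₁ t ≤ h₂ t) (t : ℝ) : periodicGreen T k h₁ t ≤ periodicGreen T k h₂ t :=
  neg_le_neg <| periodicResolvent_anti hT (neg_lt_zero.2 hk)
    (continuous_periodicResolvent hT hk.ne' hc₁ hp₁)
    (continuous_periodicResolvent hT hk.ne' hc₂ hp₂) (periodicResolvent_mono hT hk hc₁ hc₂ hle) t

/-- `periodicGreen` is a left inverse of `w ↦ -w'' + k² w` on `T`-periodic functions. With monotonicity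
this compares a lower or upper solution with its image under one step of the iteration. -/
theorem periodicGreen_sub_deriv_deriv {w : ℝ → ℝ} (hT : 0 < T) (hk : 0 < k)
    (hw : ContDiff ℝ 2 w) (hp : Function.Periodic w T) :
    periodicGreen T k (fun t => k ^ 2 * w t - deriv (deriv w) t) = w := by
  have hw1 : ContDiff ℝ 1 (deriv w) := ((contDiff_succ_iff_deriv (n := 1)).1 hw).2.2
  have hd : ∀ t, HasDerivAt w (deriv w t) t := fun t =>
    (hw.differentiable (by norm_num) t).hasDerivAt
  have hd' : ∀ t, HasDerivAt (deriv w) (deriv (deriv w) t) t := fun t =>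
    (hw1.differentiable (by norm_num) t).hasDerivAt
  have hc : Continuous w := hw.continuous
  have hc1 : Continuous (deriv w) := hw1.continuous
  have hc2 : Continuous (deriv (deriv w)) := hw1.continuous_deriv (le_refl 1)
  have hp1 : Function.Periodic (deriv w) T := fun t => by
    rw [← deriv_comp_add_const, funext hp]
  -- the inner resolvent produces `k w - w'`, the outer one `-w`
  have h1 := periodicResolvent_deriv_add (w := fun t => k * w t - deriv w t)
    (w' := fun t => k * deriv w t - deriv (deriv w) t) hT hk.ne'
    (fun t => ((hd t).const_mul k).sub (hd' t)) (by fun_prop)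
    (fun t => by simp only [hp t, hp1 t])
  have h2 := periodicResolvent_deriv_add (w := fun t => -w t) (w' := fun t => -deriv w t)
    hT (neg_ne_zero.2 hk.ne') (fun t => (hd t).neg) (by fun_prop) (fun t => by simp only [hp t])
  funext t
  unfold periodicGreen
  have e1 : (fun t => k ^ 2 * w t - deriv (deriv w) t) =
      fun t => k * deriv w t - deriv (deriv w) t + k * (k * w t - deriv w t) := by
    funext t; ring
  have e2 : (fun t => k * w t - deriv w t) = fun t => -deriv w t + -k * -w t := by
    funext t; ring
  rw [e1, h1, e2, h2, neg_neg]

end Green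

/-! ### The method of lower and upper solutions -/

theorem exists_periodic_bound {T : ℝ} {h : ℝ → ℝ} (hT : 0 < T) (hc : Continuous h)
    (hp : Function.Periodic h T) : ∃ C, 0 ≤ C ∧ ∀ t, |h t| ≤ C := by
  obtain ⟨C, hC⟩ := isCompact_Icc.exists_bound_of_continuousOn (s := Icc 0 T) hc.continuousOn
  refine ⟨|C|, abs_nonneg C, fun t => ?_⟩
  obtain ⟨y, hy, hty⟩ := hp.exists_mem_Ico₀ hT t
  rw [hty]
  exact (hC y ⟨hy.1, hy.2.le⟩).trans (le_abs_self C)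

theorem Function.Periodic.deriv_periodic {T : ℝ} {h : ℝ → ℝ} (hp : Function.Periodic h T) :
    Function.Periodic (deriv h) T := fun t => by
  rw [← deriv_comp_add_const, funext hp]

section LowerUpper

variable {T k : ℝ} {f : ℝ → ℝ → ℝ}

/-- Monotone iteration: a lower solution `α` below an upper solution `β` enclose a periodic solution of
`u'' = f(t, u)`. -/
theorem exists_periodic_solution_between {α β : ℝ → ℝ} (hT : 0 < T) (hk : 0 < k)
    (hf : Continuous fun p : ℝ × ℝ => f p.1 p.2) (hfp : ∀ t x, f (t + T) x = f t x)
    (hmono : ∀ t, Monotone fun x => k ^ 2 * x - f t x)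
    (hα : ContDiff ℝ 2 α) (hαp : Function.Periodic α T)
    (hlow : ∀ t, f t (α t) ≤ deriv (deriv α) t)
    (hβ : ContDiff ℝ 2 β) (hβp : Function.Periodic β T)
    (hupp : ∀ t, deriv (deriv β) t ≤ f t (β t)) (hαβ : ∀ t, α t ≤ β t) :
    ∃ u u' : ℝ → ℝ, Function.Periodic u T ∧ (∀ t, HasDerivAt u (u' t) t) ∧
      (∀ t, HasDerivAt u' (f t (u t)) t) ∧ ∀ t, α t ≤ u t ∧ u t ≤ β t := by
  let F : (ℝ → ℝ) → ℝ → ℝ := fun x t => k ^ 2 * x t - f t (x t)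
  let S : (ℝ → ℝ) → ℝ → ℝ := fun x => periodicGreen T k (F x)
  have hFc : ∀ x, Continuous x → Continuous (F x) := fun x hx =>
    (continuous_const.mul hx).sub (hf.comp (continuous_id.prodMk hx))
  have hFp : ∀ x, Function.Periodic x T → Function.Periodic (F x) T := fun x hx t => by
    simp only [F, hx t, hfp]
  have hFm : ∀ x y : ℝ → ℝ, (∀ t, x t ≤ y t) → ∀ t, F x t ≤ F y t := fun x y hxy t =>
    hmono t (hxy t)
  have hSc : ∀ x, Continuous x → Function.Periodic x T → Continuous (S x) := fun x hx hp =>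
    continuous_periodicGreen hT hk (hFc x hx) (hFp x hp)
  have hSp : ∀ x, Function.Periodic x T → Function.Periodic (S x) T := fun x hp =>
    periodic_periodicGreen (hFp x hp)
  have hSm : ∀ x y, Continuous x → Function.Periodic x T → Continuous y → Function.Periodic y T →
      (∀ t, x t ≤ y t) → ∀ t, S x t ≤ S y t := fun x y hx hxp hy hyp hxy =>
    periodicGreen_mono hT hk (hFc x hx) (hFp x hxp) (hFc y hy) (hFp y hyp) (hFm x y hxy)
  have hαc := hα.continuous
  have hβc := hβ.continuous
  have hαS : ∀ t, α t ≤ S α t := by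
    intro t
    have h2 : Continuous (deriv (deriv α)) :=
      ((contDiff_succ_iff_deriv (n := 1)).1 hα).2.2.continuous_deriv (le_refl 1)
    have h := congrFun (periodicGreen_sub_deriv_deriv hT hk hα hαp) t
    rw [← h]
    refine periodicGreen_mono hT hk (by fun_prop) (fun t => ?_) (hFc _ hαc) (hFp _ hαp)
      (fun t => sub_le_sub_left (hlow t) _) t
    simp only [hαp t, hαp.deriv_periodic.deriv_periodic t]
  have hSβ : ∀ t, S β t ≤ β t := by
    intro t
    have h2 : Continuous (deriv (deriv β)) :=
      ((contDiff_succ_iff_deriv (n := 1)).1 hβ).2.2.continuous_deriv (le_refl 1)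
    have h := congrFun (periodicGreen_sub_deriv_deriv hT hk hβ hβp) t
    rw [← h]
    refine periodicGreen_mono hT hk (hFc _ hβc) (hFp _ hβp) (by fun_prop) (fun t => ?_)
      (fun t => sub_le_sub_left (hupp t) _) t
    simp only [hβp t, hβp.deriv_periodic.deriv_periodic t]
  -- the iterates `x n = S^[n] α`
  let x : ℕ → ℝ → ℝ := fun n => S^[n] α
  have hxs : ∀ n, x (n + 1) = S (x n) := fun n => Function.iterate_succ_apply' S n α
  have hx : ∀ n, Continuous (x n) ∧ Function.Periodic (x n) T ∧ (∀ t, α t ≤ x n t) ∧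
      (∀ t, x n t ≤ β t) ∧ ∀ t, x n t ≤ x (n + 1) t := by
    intro n
    induction n with
    | zero => exact ⟨hαc, hαp, fun _ => le_rfl, hαβ, hαS⟩
    | succ n ih =>
      obtain ⟨hc, hp, hl, hu, hm⟩ := ih
      have hc' : Continuous (x (n + 1)) := hxs n ▸ hSc _ hc hp
      have hp' : Function.Periodic (x (n + 1)) T := hxs n ▸ hSp _ hp
      refine ⟨hc', hp', fun t => (hl t).trans (hm t), fun t => ?_, fun t => ?_⟩
      · rw [hxs n]
        exact (hSm _ _ hc hp hβc hβp hu t).trans (hSβ t)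
      · rw [hxs (n + 1)]
        nth_rewrite 1 [hxs n]
        exact hSm _ _ hc hp hc' hp' hm t
  have hxm : ∀ t, Monotone fun n => x n t := fun t => monotone_nat_of_le_succ fun n =>
    (hx n).2.2.2.2 t
  have hlim : ∀ t, ∃ l, Tendsto (fun n => x n t) atTop (𝓝 l) := fun t =>
    ⟨_, tendsto_atTop_ciSup (hxm t) ⟨β t, by rintro _ ⟨n, rfl⟩; exact (hx n).2.2.2.1 t⟩⟩
  choose u hu using hlim
  obtain ⟨A, -, hA⟩ := exists_periodic_bound hT (hFc α hαc) (hFp α hαp)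
  obtain ⟨B, -, hB⟩ := exists_periodic_bound hT (hFc β hβc) (hFp β hβp)
  have hFb : ∀ n t, |F (x n) t| ≤ max A B := fun n t => by
    have h1 := hFm α (x n) (hx n).2.2.1 t
    have h2 := hFm (x n) β (hx n).2.2.2.1 t
    rw [abs_le]
    have := (abs_le.1 (hA t)).1
    have := (abs_le.1 (hB t)).2
    have := le_max_left A B
    have := le_max_right A B
    constructor <;> linarith
  let v : ℕ → ℝ → ℝ := fun n => periodicResolvent T k (F (x n))
  have hvc : ∀ n, Continuous (v n) := fun n =>
    continuous_periodicResolvent hT hk.ne' (hFc _ (hx n).1) (hFp _ (hx n).2.1)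
  obtain ⟨A', -, hA'⟩ := exists_periodic_bound hT
    (continuous_periodicResolvent hT hk.ne' (hFc α hαc) (hFp α hαp))
    (periodic_periodicResolvent (k := k) (hFp α hαp))
  obtain ⟨B', -, hB'⟩ := exists_periodic_bound hT
    (continuous_periodicResolvent hT hk.ne' (hFc β hβc) (hFp β hβp))
    (periodic_periodicResolvent (k := k) (hFp β hβp))
  have hvb : ∀ n t, |v n t| ≤ max A' B' := fun n t => by
    have h1 := periodicResolvent_mono hT hk (hFc α hαc) (hFc _ (hx n).1)
      (hFm α (x n) (hx n).2.2.1) t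
    have h2 := periodicResolvent_mono hT hk (hFc _ (hx n).1) (hFc β hβc)
      (hFm (x n) β (hx n).2.2.2.1) t
    rw [abs_le]
    have := (abs_le.1 (hA' t)).1
    have := (abs_le.1 (hB' t)).2
    have := le_max_left A' B'
    have := le_max_right A' B'
    constructor <;> simp only [v] <;> linarith
  obtain ⟨A'', hA0, hA''⟩ := exists_periodic_bound hT hαc hαp
  obtain ⟨B'', hB0, hB''⟩ := exists_periodic_bound hT hβc hβp
  have hxb : ∀ n t, |x n t| ≤ max A'' B'' := fun n t => by
    have h1 := (hx n).2.2.1 t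
    have h2 := (hx n).2.2.2.1 t
    rw [abs_le]
    have := (abs_le.1 (hA'' t)).1
    have := (abs_le.1 (hB'' t)).2
    have := le_max_left A'' B''
    have := le_max_right A'' B''
    constructor <;> linarith
  -- the derivatives `k x - v` of the iterates are uniformly bounded, so the limit is Lipschitz
  have hLip : ∀ n s t, |x (n + 1) s - x (n + 1) t| ≤
      (k * max A'' B'' + max A' B') * |s - t| := fun n s t => by
    refine Convex.norm_image_sub_le_of_norm_hasDerivWithin_le (s := univ) (x := t) (y := s)
      (f' := fun t => k * x (n + 1) t - v n t) (fun r _ => ?_) (fun r _ => ?_) convex_univ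
      (mem_univ _) (mem_univ _)
    · rw [hxs n]
      exact (hasDerivAt_periodicGreen hT hk (hFc _ (hx n).1) (hFp _ (hx n).2.1) r).hasDerivWithinAt
    · refine (abs_sub _ _).trans (add_le_add ?_ (hvb n r))
      rw [abs_mul, abs_of_pos hk]
      exact mul_le_mul_of_nonneg_left (hxb _ _) hk.le
  have huc : Continuous u := by
    have hle : ∀ s t, |u s - u t| ≤ (k * max A'' B'' + max A' B') * |s - t| := fun s t =>
      le_of_tendsto (((hu s).comp (tendsto_add_atTop_nat 1)).sub
        ((hu t).comp (tendsto_add_atTop_nat 1))).abs (Eventually.of_forall fun n => hLip n s t)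
    exact (LipschitzWith.of_dist_le_mul (K := (k * max A'' B'' + max A' B').toNNReal)
      fun s t => (hle s t).trans
        (mul_le_mul_of_nonneg_right (Real.le_coe_toNNReal _) (abs_nonneg _))).continuous
  have hup : Function.Periodic u T := fun t => by
    refine tendsto_nhds_unique (hu (t + T)) ?_
    simp only [(hx _).2.1 t]
    exact hu t
  have hFu : ∀ t, Tendsto (fun n => F (x n) t) atTop (𝓝 (F u t)) := fun t => by
    have hft : Continuous (f t) := hf.comp (continuous_const.prodMk continuous_id)
    exact ((hu t).const_mul _).sub ((hft.tendsto _).comp (hu t))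
  have hSu : S u = u := by
    funext t
    have h1 := fun t => tendsto_periodicResolvent (T := T) (k := k)
      (fun n => hFc _ (hx n).1) hFb hFu t
    have h2 := (tendsto_periodicResolvent (T := T) (k := -k) hvc hvb h1 t).neg
    refine tendsto_nhds_unique h2 (((hu t).comp (tendsto_add_atTop_nat 1)).congr fun n => ?_)
    simp only [Function.comp, hxs n]
    rfl
  have hd := hasDerivAt_periodicGreen hT hk (hFc u huc) (hFp u hup)
  have hd' := hasDerivAt_periodicResolvent hT hk.ne' (hFc u huc) (hFp u hup)
  rw [show periodicGreen T k (F u) = u from hSu] at hd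
  refine ⟨u, fun t => k * u t - periodicResolvent T k (F u) t, hup, hd, fun t => ?_, fun t =>
    ⟨ge_of_tendsto' (hu t) fun n => (hx n).2.2.1 t, le_of_tendsto' (hu t) fun n =>
      (hx n).2.2.2.1 t⟩⟩
  refine (((hd t).const_mul k).sub (hd' t)).congr_deriv ?_
  simp only [F]
  ring

/-- Solutions of `u'' = f(t, u)` with smooth `f` are smooth. -/
theorem contDiff_of_hasDerivAt_hasDerivAt {u u' : ℝ → ℝ}
    (hf : ContDiff ℝ ∞ fun p : ℝ × ℝ => f p.1 p.2) (hu : ∀ t, HasDerivAt u (u' t) t)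
    (hu' : ∀ t, HasDerivAt u' (f t (u t)) t) : ContDiff ℝ ∞ u := by
  have e1 : deriv u = u' := funext fun t => (hu t).deriv
  have e2 : deriv u' = fun t => f t (u t) := funext fun t => (hu' t).deriv
  have key : ∀ n : ℕ, ContDiff ℝ n u ∧ ContDiff ℝ n u' := by
    intro n
    induction n with
    | zero =>
      simp only [Nat.cast_zero, contDiff_zero]
      exact ⟨continuous_iff_continuousAt.2 fun t => (hu t).continuousAt,
        continuous_iff_continuousAt.2 fun t => (hu' t).continuousAt⟩
    | succ n ih =>
      push_cast
      rw [contDiff_succ_iff_deriv, contDiff_succ_iff_deriv, e1, e2]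
      refine ⟨⟨fun t => (hu t).differentiableAt, by simp, ih.2⟩,
        ⟨fun t => (hu' t).differentiableAt, by simp, ?_⟩⟩
      exact (hf.of_le (mod_cast le_top)).comp (contDiff_id.prodMk ih.1)
  exact contDiff_infty.2 fun n => (key n).1

end LowerUpper

/-! ### Averaging of a fast oscillation -/

/-- The primitive is again normalized to mean zero, so that the construction can be repeated. -/
theorem exists_periodic_primitive {T : ℝ} {g : ℝ → ℝ} (hT : 0 < T) (hg : ContDiff ℝ ∞ g)
    (hgT : Function.Periodic g T) (hg0 : ∫ t in (0 : ℝ)..T, g t = 0) :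
    ∃ P : ℝ → ℝ, ContDiff ℝ ∞ P ∧ deriv P = g ∧ Function.Periodic P T ∧
      ∫ t in (0 : ℝ)..T, P t = 0 := by
  have hc := hg.continuous
  let I : ℝ → ℝ := fun t => ∫ r in (0 : ℝ)..t, g r
  have hI : ∀ t, HasDerivAt I (g t) t := fun t => (hc.integral_hasStrictDerivAt 0 t).hasDerivAt
  have hIc : Continuous I := continuous_iff_continuousAt.2 fun t => (hI t).continuousAt
  let m : ℝ := T⁻¹ * ∫ t in (0 : ℝ)..T, I t
  have hP : ∀ t, HasDerivAt (fun t => I t - m) (g t) t := fun t => (hI t).sub_const m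
  have hd : deriv (fun t => I t - m) = g := funext fun t => (hP t).deriv
  refine ⟨fun t => I t - m, ?_, hd, fun t => ?_, ?_⟩
  · rw [contDiff_infty_iff_deriv, hd]
    exact ⟨fun t => (hP t).differentiableAt, hg⟩
  · have h1 : I (t + T) = I t + ∫ r in t..(t + T), g r :=
      (intervalIntegral.integral_add_adjacent_intervals (hc.intervalIntegrable _ _)
        (hc.intervalIntegrable _ _)).symm
    have h2 := hgT.intervalIntegral_add_eq t 0
    rw [zero_add, hg0] at h2
    simp only [h1, h2, add_zero]
  · rw [intervalIntegral.integral_sub (hIc.intervalIntegrable _ _) (by simp),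
      intervalIntegral.integral_const]
    simp only [m, smul_eq_mul, sub_zero]
    field_simp
    ring

/-- The rapidly oscillating forcing `g(λ t) W(t)` is the second derivative of a small function, up to an
error `O(1 / λ)`: take `α(t) = a + λ⁻² G(λ t) W(t)` with `G'' = g`. -/
theorem exists_oscillating_corrector {T : ℝ} {g W : ℝ → ℝ} (hT : 0 < T) (hg : ContDiff ℝ ∞ g)
    (hgT : Function.Periodic g T) (hg0 : ∫ t in (0 : ℝ)..T, g t = 0) (hW : ContDiff ℝ ∞ W)
    (hWT : Function.Periodic W T) :
    ∃ C : ℝ, ∀ lam : ℕ, 1 ≤ lam → ∀ a : ℝ, ∃ α : ℝ → ℝ, ContDiff ℝ 2 α ∧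
      Function.Periodic α T ∧ (∀ t, |α t - a| ≤ C / lam) ∧
      ∀ t, |deriv (deriv α) t - g (lam * t) * W t| ≤ C / lam := by
  obtain ⟨G₁, hG₁, hG₁', hG₁T, hG₁0⟩ := exists_periodic_primitive hT hg hgT hg0
  obtain ⟨G, hG, hG', hGT, -⟩ := exists_periodic_primitive hT hG₁ hG₁T hG₁0
  have hW1 : ContDiff ℝ ∞ (deriv W) := (contDiff_infty_iff_deriv.1 hW).2
  have hW2 : ContDiff ℝ ∞ (deriv (deriv W)) := (contDiff_infty_iff_deriv.1 hW1).2
  obtain ⟨A, hA0, hA⟩ := exists_periodic_bound hT hG.continuous hGT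
  obtain ⟨A₁, hA₁0, hA₁⟩ := exists_periodic_bound hT hG₁.continuous hG₁T
  obtain ⟨B, hB0, hB⟩ := exists_periodic_bound hT hW.continuous hWT
  obtain ⟨B₁, hB₁0, hB₁⟩ := exists_periodic_bound hT hW1.continuous hWT.deriv_periodic
  obtain ⟨B₂, hB₂0, hB₂⟩ := exists_periodic_bound hT hW2.continuous
    hWT.deriv_periodic.deriv_periodic
  refine ⟨A * B + (2 * (A₁ * B₁) + A * B₂), fun lam hlam a => ?_⟩
  have hl : (1 : ℝ) ≤ lam := mod_cast hlam
  have hl0 : (0 : ℝ) < lam := by linarith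
  have hl2 : ((lam : ℝ) ^ 2)⁻¹ ≤ (lam : ℝ)⁻¹ := by
    apply inv_anti₀ hl0; nlinarith
  have hlp : 0 ≤ ((lam : ℝ) ^ 2)⁻¹ := by positivity
  have hlp1 : 0 ≤ (lam : ℝ)⁻¹ := by positivity
  have dG : ∀ t, HasDerivAt (fun t => G (lam * t)) (G₁ (lam * t) * lam) t := fun t => by
    have h := (hG.differentiable (by simp) (lam * t)).hasDerivAt
    rw [hG'] at h
    exact (h.comp t ((hasDerivAt_id t).const_mul (lam : ℝ))).congr_deriv (by ring)
  have dG₁ : ∀ t, HasDerivAt (fun t => G₁ (lam * t)) (g (lam * t) * lam) t := fun t => by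
    have h := (hG₁.differentiable (by simp) (lam * t)).hasDerivAt
    rw [hG₁'] at h
    exact (h.comp t ((hasDerivAt_id t).const_mul (lam : ℝ))).congr_deriv (by ring)
  have dW : ∀ t, HasDerivAt W (deriv W t) t := fun t =>
    (hW.differentiable (by simp) t).hasDerivAt
  have dW1 : ∀ t, HasDerivAt (deriv W) (deriv (deriv W) t) t := fun t =>
    (hW1.differentiable (by simp) t).hasDerivAt
  have d1 : deriv (fun t => a + ((lam : ℝ) ^ 2)⁻¹ * (G (lam * t) * W t)) = fun t =>
      ((lam : ℝ) ^ 2)⁻¹ * (G₁ (lam * t) * lam * W t + G (lam * t) * deriv W t) :=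
    funext fun t => ((((dG t).mul (dW t)).const_mul _).const_add a).deriv
  have d2 : ∀ t, deriv (deriv (fun t => a + ((lam : ℝ) ^ 2)⁻¹ * (G (lam * t) * W t))) t =
      g (lam * t) * W t + ((lam : ℝ)⁻¹ * (2 * (G₁ (lam * t) * deriv W t))
        + ((lam : ℝ) ^ 2)⁻¹ * (G (lam * t) * deriv (deriv W) t)) := fun t => by
    rw [d1]
    refine ((((((dG₁ t).mul_const (lam : ℝ)).mul (dW t)).add
      ((dG t).mul (dW1 t))).const_mul _).congr_deriv ?_).deriv
    field_simp
    ring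
  have hm : ∀ {x y X Y : ℝ}, 0 ≤ X → |x| ≤ X → |y| ≤ Y → |x * y| ≤ X * Y := fun hX hx hy => by
    rw [abs_mul]; exact mul_le_mul hx hy (abs_nonneg _) hX
  refine ⟨fun t => a + ((lam : ℝ) ^ 2)⁻¹ * (G (lam * t) * W t), ?_, fun t => ?_, fun t => ?_,
    fun t => ?_⟩
  · have hG2 : ContDiff ℝ 2 G := mod_cast contDiff_infty.1 hG 2
    have hW2 : ContDiff ℝ 2 W := mod_cast contDiff_infty.1 hW 2
    fun_prop
  · have : G (lam * (t + T)) = G (lam * t) := by rw [mul_add]; exact hGT.nat_mul lam _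
    simp only [this, hWT t]
  · have h1 := hm hA0 (hA (lam * t)) (hB t)
    simp only [add_sub_cancel_left]
    rw [abs_mul, abs_of_nonneg hlp, div_eq_inv_mul]
    refine mul_le_mul hl2 (h1.trans ?_) (abs_nonneg _) hlp1
    have : 0 ≤ 2 * (A₁ * B₁) + A * B₂ := by positivity
    linarith
  · have h1 := hm hA₁0 (hA₁ (lam * t)) (hB₁ t)
    have h2 := hm hA0 (hA (lam * t)) (hB₂ t)
    rw [d2, add_sub_cancel_left, div_eq_inv_mul, mul_add, mul_add]
    refine (abs_add_le _ _).trans ?_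
    have e1 : |(lam : ℝ)⁻¹ * (2 * (G₁ (lam * t) * deriv W t))| ≤ (lam : ℝ)⁻¹ * (2 * (A₁ * B₁)) := by
      rw [abs_mul, abs_of_nonneg hlp1, abs_mul, abs_two]
      gcongr
    have e2 : |((lam : ℝ) ^ 2)⁻¹ * (G (lam * t) * deriv (deriv W) t)| ≤
        (lam : ℝ)⁻¹ * (A * B₂) := by
      rw [abs_mul, abs_of_nonneg hlp]
      exact mul_le_mul hl2 h2 (abs_nonneg _) hlp1
    have : 0 ≤ (lam : ℝ)⁻¹ * (A * B) := by positivity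
    linarith

/-! ### Elementary facts on periodic and continuous functions and on the vertical slope -/

theorem exists_lipschitz_of_periodic {T : ℝ} {h : ℝ → ℝ} (hT : 0 < T) (hh : ContDiff ℝ ∞ h)
    (hp : Function.Periodic h T) : ∃ L, 0 ≤ L ∧ ∀ x y, |h x - h y| ≤ L * |x - y| := by
  obtain ⟨L, hL0, hL⟩ := exists_periodic_bound hT
    (contDiff_infty_iff_deriv.1 hh).2.continuous hp.deriv_periodic
  exact ⟨L, hL0, fun x y => Convex.norm_image_sub_le_of_norm_deriv_le (s := univ)
    (fun r _ => hh.differentiable (by simp) r) (fun r _ => hL r) convex_univ (mem_univ y)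
    (mem_univ x)⟩

theorem Function.Periodic.abs_sub_le_mul_of_abs_deriv_le {T c : ℝ} {h : ℝ → ℝ} (hT : 0 < T)
    (hp : Function.Periodic h T) (hd : Differentiable ℝ h) (hc : ∀ t, |deriv h t| ≤ c) (t : ℝ) :
    |h t - h 0| ≤ c * T := by
  obtain ⟨y, hy, hty⟩ := hp.exists_mem_Ico₀ hT t
  rw [hty]
  have h1 : |h y - h 0| ≤ c * |y - 0| := Convex.norm_image_sub_le_of_norm_deriv_le (s := univ)
    (fun r _ => hd r) (fun r _ => hc r) convex_univ (mem_univ 0) (mem_univ y)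
  refine h1.trans (mul_le_mul_of_nonneg_left ?_ ((abs_nonneg _).trans (hc 0)))
  rw [sub_zero, abs_of_nonneg hy.1]
  exact hy.2.le

theorem Continuous.lt_of_forall_ne {h : ℝ → ℝ} (hc : Continuous h) {a t₀ : ℝ} (h0 : h t₀ < a)
    (hne : ∀ t, h t ≠ a) (t : ℝ) : h t < a := by
  by_contra! hta
  obtain ⟨r, hr⟩ := mem_range_of_exists_le_of_exists_ge hc ⟨t₀, h0.le⟩ ⟨t, hta⟩
  exact hne r hr

theorem Continuous.gt_of_forall_ne {h : ℝ → ℝ} (hc : Continuous h) {a t₀ : ℝ} (h0 : a < h t₀)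
    (hne : ∀ t, h t ≠ a) (t : ℝ) : a < h t := by
  by_contra! hta
  obtain ⟨r, hr⟩ := mem_range_of_exists_le_of_exists_ge hc ⟨t, hta⟩ ⟨t₀, h0.le⟩
  exact hne r hr

theorem Continuous.exists_mem_Ioo_eq {h : ℝ → ℝ} (hc : Continuous h) {p q y : ℝ} (hpq : p ≤ q)
    (hp : h p < y) (hq : y < h q) : ∃ x, p < x ∧ x < q ∧ h x = y := by
  obtain ⟨x, hx, hxy⟩ := intermediate_value_Ioo hpq hc.continuousOn ⟨hp, hq⟩
  exact ⟨x, hx.1, hx.2, hxy⟩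

theorem abs_verticalSlope_sub_angle_le {ξ η : ℝ → ℝ}
    (hu : ∀ s, deriv ξ s ^ 2 + deriv η s ^ 2 = 1) (a b s : ℝ) :
    |verticalSlope ξ η a s - verticalSlope ξ η b s| ≤ 2 * |a - b| := by
  have h1 : |deriv ξ s| ≤ 1 := abs_le_one_iff_mul_self_le_one.2 (by nlinarith [hu s])
  have h2 : |deriv η s| ≤ 1 := abs_le_one_iff_mul_self_le_one.2 (by nlinarith [hu s])
  have h3 : |Real.sin a - Real.sin b| ≤ |a - b| := Real.abs_sin_sub_sin_le a b
  have h4 : |Real.cos a - Real.cos b| ≤ |a - b| := Real.abs_cos_sub_cos_le a b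
  unfold verticalSlope
  calc _ = |deriv ξ s * (Real.sin a - Real.sin b) + deriv η s * (Real.cos a - Real.cos b)| := by
        congr 1; ring
    _ ≤ |deriv ξ s| * |Real.sin a - Real.sin b| + |deriv η s| * |Real.cos a - Real.cos b| := by
        rw [← abs_mul, ← abs_mul]; exact abs_add_le _ _
    _ ≤ 1 * |a - b| + 1 * |a - b| := by gcongr
    _ = 2 * |a - b| := by ring

theorem abs_verticalSlope_sub_le {ξ η : ℝ → ℝ} {L₁ L₂ : ℝ}
    (h₁ : ∀ x y, |deriv ξ x - deriv ξ y| ≤ L₁ * |x - y|)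
    (h₂ : ∀ x y, |deriv η x - deriv η y| ≤ L₂ * |x - y|) (a x y : ℝ) :
    |verticalSlope ξ η a x - verticalSlope ξ η a y| ≤ (L₁ + L₂) * |x - y| := by
  unfold verticalSlope
  calc _ = |(deriv ξ x - deriv ξ y) * Real.sin a + (deriv η x - deriv η y) * Real.cos a| := by
        congr 1; ring
    _ ≤ |deriv ξ x - deriv ξ y| * |Real.sin a| + |deriv η x - deriv η y| * |Real.cos a| := by
        rw [← abs_mul, ← abs_mul]; exact abs_add_le _ _
    _ ≤ |deriv ξ x - deriv ξ y| * 1 + |deriv η x - deriv η y| * 1 := by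
        gcongr
        · exact Real.abs_sin_le_one a
        · exact Real.abs_cos_le_one a
    _ ≤ (L₁ + L₂) * |x - y| := by linarith [h₁ x y, h₂ x y]

/-! ### Barriers and solutions for the rotating curve -/

/-- The right-hand side `f(t, x)` of the equation of motion written as `s'' = f(t, s)`. -/
noncomputable def tangentialForce (ξ η φ g : ℝ → ℝ) (lam t x : ℝ) : ℝ :=
  (1 + g (lam * t)) * verticalSlope ξ η (φ t) x
    - deriv (deriv φ) t * (ξ x * deriv η x - η x * deriv ξ x)
    + deriv φ t ^ 2 * (ξ x * deriv ξ x + η x * deriv η x)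

/-- Lower and upper solutions of the equation of motion enclose a smooth periodic solution. -/
theorem exists_periodic_tangentialForce_solution {ξ η φ g α β : ℝ → ℝ} {ℓ T : ℝ} {lam : ℕ}
    (hcurve : IsStrictlyConvexClosedCurve ξ η ℓ) (hT : 0 < T) (hg : ContDiff ℝ ∞ g)
    (hgT : Function.Periodic g T) (hφ : ContDiff ℝ ∞ φ) (hφT : Function.Periodic φ T)
    (hα : ContDiff ℝ 2 α) (hαT : Function.Periodic α T)
    (hlow : ∀ t, tangentialForce ξ η φ g lam t (α t) ≤ deriv (deriv α) t)
    (hβ : ContDiff ℝ 2 β) (hβT : Function.Periodic β T)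
    (hupp : ∀ t, deriv (deriv β) t ≤ tangentialForce ξ η φ g lam t (β t))
    (hαβ : ∀ t, α t ≤ β t) :
    ∃ s : ℝ → ℝ, IsRotatingCurveSolution ξ η φ g lam s ∧ Function.Periodic s T ∧
      ∀ t, α t ≤ s t ∧ s t ≤ β t := by
  have hℓ := hcurve.length_pos
  have hξ := hcurve.smooth_fst
  have hη := hcurve.smooth_snd
  have hξ1 : ContDiff ℝ ∞ (deriv ξ) := (contDiff_infty_iff_deriv.1 hξ).2
  have hη1 : ContDiff ℝ ∞ (deriv η) := (contDiff_infty_iff_deriv.1 hη).2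
  have hφ1 : ContDiff ℝ ∞ (deriv φ) := (contDiff_infty_iff_deriv.1 hφ).2
  have hφ2 : ContDiff ℝ ∞ (deriv (deriv φ)) := (contDiff_infty_iff_deriv.1 hφ1).2
  have hφ1T := hφT.deriv_periodic
  have hφ2T := hφ1T.deriv_periodic
  have hξp := hcurve.periodic_fst
  have hηp := hcurve.periodic_snd
  have hξ1p := hξp.deriv_periodic
  have hη1p := hηp.deriv_periodic
  have hf : ContDiff ℝ ∞ fun p : ℝ × ℝ => tangentialForce ξ η φ g lam p.1 p.2 := by
    unfold tangentialForce verticalSlope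
    fun_prop
  have hfp : ∀ t x, tangentialForce ξ η φ g lam (t + T) x = tangentialForce ξ η φ g lam t x := by
    intro t x
    have : g (lam * (t + T)) = g (lam * t) := by rw [mul_add]; exact hgT.nat_mul lam _
    unfold tangentialForce
    rw [this, hφT t, hφ1T t, hφ2T t]
  -- the force is Lipschitz in the position, uniformly in time
  obtain ⟨L₁, hL₁0, hL₁⟩ := exists_lipschitz_of_periodic hℓ hξ1 hξ1p
  obtain ⟨L₂, hL₂0, hL₂⟩ := exists_lipschitz_of_periodic hℓ hη1 hη1p
  obtain ⟨L₃, hL₃0, hL₃⟩ := exists_lipschitz_of_periodic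
    (h := fun x => ξ x * deriv η x - η x * deriv ξ x) hℓ (by fun_prop)
    fun x => by simp only [hξp x, hηp x, hξ1p x, hη1p x]
  obtain ⟨L₄, hL₄0, hL₄⟩ := exists_lipschitz_of_periodic
    (h := fun x => ξ x * deriv ξ x + η x * deriv η x) hℓ (by fun_prop)
    fun x => by simp only [hξp x, hηp x, hξ1p x, hη1p x]
  obtain ⟨Mg, hMg0, hMg⟩ := exists_periodic_bound hT hg.continuous hgT
  obtain ⟨M₁, hM₁0, hM₁⟩ := exists_periodic_bound (h := fun t => deriv φ t ^ 2) hT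
    (by fun_prop) fun t => by simp only [hφ1T t]
  obtain ⟨M₂, hM₂0, hM₂⟩ := exists_periodic_bound hT hφ2.continuous hφ2T
  let K : ℝ := (1 + Mg) * (L₁ + L₂) + M₂ * L₃ + M₁ * L₄
  have hK0 : 0 ≤ K := by positivity
  have hK : ∀ t x y, x ≤ y →
      tangentialForce ξ η φ g lam t y - tangentialForce ξ η φ g lam t x ≤ K * (y - x) := by
    intro t x y hxy
    have hm : ∀ {p q X Y : ℝ}, 0 ≤ X → |p| ≤ X → |q| ≤ Y → |p * q| ≤ X * Y := fun hX hx hy => by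
      rw [abs_mul]; exact mul_le_mul hx hy (abs_nonneg _) hX
    have hg1 : |1 + g (lam * t)| ≤ 1 + Mg :=
      (abs_add_le _ _).trans (by rw [abs_one]; linarith [hMg (lam * t)])
    have h1 := hm (by positivity) hg1 (abs_verticalSlope_sub_le hL₁ hL₂ (φ t) y x)
    have h2 := hm hM₂0 (hM₂ t) (hL₃ y x)
    have h3 := hm hM₁0 (hM₁ t) (hL₄ y x)
    rw [abs_of_nonneg (sub_nonneg.2 hxy)] at h1 h2 h3
    have h1' := (abs_le.1 h1).2
    have h2' := (abs_le.1 h2).1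
    have h3' := (abs_le.1 h3).2
    simp only [tangentialForce, K]
    linarith
  obtain ⟨u, u', huT, hu, hu', hb⟩ := exists_periodic_solution_between (k := K + 1) hT
    (by linarith) hf.continuous hfp (fun t x y hxy => by
      have h1 := hK t x y hxy
      have h2 : K * (y - x) ≤ (K + 1) ^ 2 * (y - x) :=
        mul_le_mul_of_nonneg_right (by nlinarith) (sub_nonneg.2 hxy)
      simp only
      linarith) hα hαT hlow hβ hβT hupp hαβ
  refine ⟨u, ⟨contDiff_of_hasDerivAt_hasDerivAt hf hu hu', fun t => ?_⟩, huT, hb⟩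
  rw [funext fun t => (hu t).deriv, (hu' t).deriv]
  unfold tangentialForce
  ring

/-- For large `λ` there is a periodic function `α` close to the constant `a` for which `α'' - f(t, α)` is
close to minus the vertical slope at `a`. It is a lower solution if that slope is negative enough, and
an upper solution if it is positive enough. The bound `δ` controls the inertial terms of the force. -/
theorem exists_approximate_equilibrium {ξ η φ g : ℝ → ℝ} {ℓ T δ : ℝ}
    (hcurve : IsStrictlyConvexClosedCurve ξ η ℓ) (hT : 0 < T) (hg : ContDiff ℝ ∞ g)
    (hgT : Function.Periodic g T) (hg0 : ∫ t in (0 : ℝ)..T, g t = 0)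
    (hφ : ContDiff ℝ ∞ φ) (hφT : Function.Periodic φ T)
    (hδ : ∀ t x, |deriv (deriv φ) t * (ξ x * deriv η x - η x * deriv ξ x)| +
      |deriv φ t ^ 2 * (ξ x * deriv ξ x + η x * deriv η x)| ≤ δ) (a : ℝ) {ε : ℝ} (hε : 0 < ε) :
    ∀ᶠ lam : ℕ in atTop, ∃ α : ℝ → ℝ, ContDiff ℝ 2 α ∧ Function.Periodic α T ∧
      (∀ t, |α t - a| < ε) ∧ ∀ t, |deriv (deriv α) t - tangentialForce ξ η φ g lam t (α t)
        + verticalSlope ξ η (φ t) a| ≤ δ + ε := by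
  have hξ1 : ContDiff ℝ ∞ (deriv ξ) := (contDiff_infty_iff_deriv.1 hcurve.smooth_fst).2
  have hη1 : ContDiff ℝ ∞ (deriv η) := (contDiff_infty_iff_deriv.1 hcurve.smooth_snd).2
  obtain ⟨L₁, hL₁0, hL₁⟩ := exists_lipschitz_of_periodic hcurve.length_pos hξ1
    hcurve.periodic_fst.deriv_periodic
  obtain ⟨L₂, hL₂0, hL₂⟩ := exists_lipschitz_of_periodic hcurve.length_pos hη1
    hcurve.periodic_snd.deriv_periodic
  obtain ⟨M, hM0, hM⟩ := exists_periodic_bound hT hg.continuous hgT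
  obtain ⟨C, hC⟩ := exists_oscillating_corrector (W := fun t => verticalSlope ξ η (φ t) a) hT hg
    hgT hg0 (by unfold verticalSlope; fun_prop) (fun t => by simp only [hφT t])
  have hlim : ∀ D : ℝ, ∀ᶠ lam : ℕ in atTop, D / lam < ε := fun D =>
    (tendsto_const_div_atTop_nhds_zero_nat D).eventually_lt_const hε
  filter_upwards [hlim C, hlim (C + (1 + M) * ((L₁ + L₂) * C)), eventually_ge_atTop 1]
    with lam h1 h2 hlam
  obtain ⟨α, hα, hαT, hαa, hα2⟩ := hC lam hlam a
  refine ⟨α, hα, hαT, fun t => (hαa t).trans_lt h1, fun t => ?_⟩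
  have hV : |verticalSlope ξ η (φ t) (α t) - verticalSlope ξ η (φ t) a| ≤ (L₁ + L₂) * (C / lam) :=
    (abs_verticalSlope_sub_le hL₁ hL₂ _ _ _).trans
      (mul_le_mul_of_nonneg_left (hαa t) (by positivity))
  have hg1 : |1 + g (lam * t)| ≤ 1 + M :=
    (abs_add_le _ _).trans (by rw [abs_one]; linarith [hM (lam * t)])
  have hgV : |(1 + g (lam * t)) * (verticalSlope ξ η (φ t) (α t) - verticalSlope ξ η (φ t) a)| ≤
      (1 + M) * ((L₁ + L₂) * (C / lam)) := by
    rw [abs_mul]; exact mul_le_mul hg1 hV (abs_nonneg _) (by positivity)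
  have e : (C + (1 + M) * ((L₁ + L₂) * C)) / lam =
      C / lam + (1 + M) * ((L₁ + L₂) * (C / lam)) := by ring
  rw [e] at h2
  have hδ' := hδ t (α t)
  have k1 := abs_le.1 (hα2 t)
  have k2 := abs_le.1 hgV
  have k3 := abs_le.1 (le_refl |deriv (deriv φ) t *
    (ξ (α t) * deriv η (α t) - η (α t) * deriv ξ (α t))|)
  have k4 := abs_le.1 (le_refl |deriv φ t ^ 2 *
    (ξ (α t) * deriv ξ (α t) + η (α t) * deriv η (α t))|)
  unfold tangentialForce
  rw [abs_le]
  constructor <;> linarith [k1.1, k1.2, k2.1, k2.2, k3.1, k3.2, k4.1, k4.2]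

/-- Constants between `s₁` and `s₂` at which the slope keeps its sign. The points `a'` and `b'` have slope
`-3/4` and `3/4` at time `0`; they separate `a` from `s₁` and `b` from `s₂` by a margin uniform in time,
because the slope `∓1` at `s₁` and `s₂` cannot change by `1/4` when the angle varies so little. -/
theorem exists_barrier_points {ξ η φ s₁ s₂ : ℝ → ℝ} {ℓ : ℝ}
    (hcurve : IsStrictlyConvexClosedCurve ξ η ℓ) (hφ : ∀ t, |φ t - φ 0| ≤ 1 / 16)
    (hs : AreVerticalTangentPoints ξ η ℓ φ s₁ s₂) :
    ∃ a' a b b' : ℝ, a' < a ∧ a < b ∧ b < b' ∧ (∀ t, s₁ t < a') ∧ (∀ t, b' < s₂ t) ∧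
      (∀ t, verticalSlope ξ η (φ t) a ≤ -(3 / 8)) ∧
      ∀ t, 3 / 8 ≤ verticalSlope ξ η (φ t) b := by
  have hξ1 : ContDiff ℝ ∞ (deriv ξ) := (contDiff_infty_iff_deriv.1 hcurve.smooth_fst).2
  have hη1 : ContDiff ℝ ∞ (deriv η) := (contDiff_infty_iff_deriv.1 hcurve.smooth_snd).2
  have hVc : Continuous (verticalSlope ξ η (φ 0)) := by unfold verticalSlope; fun_prop
  have hV : ∀ t s, |verticalSlope ξ η (φ t) s - verticalSlope ξ η (φ 0) s| ≤ 1 / 8 := fun t s =>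
    (abs_verticalSlope_sub_angle_le hcurve.unit_speed _ _ s).trans (by linarith [hφ t])
  have h₁ := hs.slope_left 0
  have h₂ := hs.slope_right 0
  obtain ⟨a', ha', haq', ea'⟩ := hVc.exists_mem_Ioo_eq (y := -(3 / 4)) (hs.left_lt_right 0).le
    (by rw [h₁]; norm_num) (by rw [h₂]; norm_num)
  obtain ⟨a, ha, haq, ea⟩ := hVc.exists_mem_Ioo_eq (y := -(1 / 2)) haq'.le
    (by rw [ea']; norm_num) (by rw [h₂]; norm_num)
  obtain ⟨b, hb, hbq, eb⟩ := hVc.exists_mem_Ioo_eq (y := 1 / 2) haq.le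
    (by rw [ea]; norm_num) (by rw [h₂]; norm_num)
  obtain ⟨b', hb', hbq', eb'⟩ := hVc.exists_mem_Ioo_eq (y := 3 / 4) hbq.le
    (by rw [eb]; norm_num) (by rw [h₂]; norm_num)
  refine ⟨a', a, b, b', ha, hb, hb', hs.continuous_left.lt_of_forall_ne ha' fun t ht => ?_,
    hs.continuous_right.gt_of_forall_ne hbq' fun t ht => ?_, fun t => ?_, fun t => ?_⟩
  · have := (abs_le.1 (hV t (s₁ t))).1
    rw [hs.slope_left t, ht, ea'] at this
    linarith
  · have := (abs_le.1 (hV t (s₂ t))).2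
    rw [hs.slope_right t, ht, eb'] at this
    linarith
  · have := (abs_le.1 (hV t a)).2
    rw [ea] at this
    linarith
  · have := (abs_le.1 (hV t b)).1
    rw [eb] at this
    linarith

theorem theorem3p9 (ξ η : ℝ → ℝ) (ℓ : ℝ) (hcurve : IsStrictlyConvexClosedCurve ξ η ℓ)
    (T : ℝ) (hT : 0 < T) (g : ℝ → ℝ) (hg : ContDiff ℝ ∞ g) (hgT : Function.Periodic g T)
    (hg0 : ∫ t in (0 : ℝ)..T, g t = 0) :
    ∃ c : ℝ, 0 < c ∧
      ∀ φ : ℝ → ℝ, ContDiff ℝ ∞ φ → Function.Periodic φ T →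
        (∀ t, |deriv φ t| < c) → (∀ t, |deriv (deriv φ) t| < c) →
        ∀ s₁ s₂ : ℝ → ℝ, AreVerticalTangentPoints ξ η ℓ φ s₁ s₂ →
          ∃ lam₀ : ℕ, ∀ lam : ℕ, lam₀ ≤ lam →
            ∃ s : ℝ → ℝ, IsRotatingCurveSolution ξ η φ g (lam : ℝ) s ∧ Function.Periodic s T ∧
              ∀ t, s₁ t < s t ∧ s t < s₂ t := by
  have hξ := hcurve.smooth_fst
  have hη := hcurve.smooth_snd
  have hξ1 : ContDiff ℝ ∞ (deriv ξ) := (contDiff_infty_iff_deriv.1 hξ).2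
  have hη1 : ContDiff ℝ ∞ (deriv η) := (contDiff_infty_iff_deriv.1 hη).2
  have hξp := hcurve.periodic_fst
  have hηp := hcurve.periodic_snd
  have hξ1p := hξp.deriv_periodic
  have hη1p := hηp.deriv_periodic
  obtain ⟨A, hA0, hA⟩ := exists_periodic_bound
    (h := fun x => ξ x * deriv η x - η x * deriv ξ x) hcurve.length_pos (by fun_prop)
    fun x => by simp only [hξp x, hηp x, hξ1p x, hη1p x]
  obtain ⟨B, hB0, hB⟩ := exists_periodic_bound
    (h := fun x => ξ x * deriv ξ x + η x * deriv η x) hcurve.length_pos (by fun_prop)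
    fun x => by simp only [hξp x, hηp x, hξ1p x, hη1p x]
  -- `c ≤ 1`, `c * T ≤ 1 / 16` and `c * A + c ^ 2 * B ≤ 1 / 16`
  have hS : 0 < 16 * (1 + T + A + B) := by positivity
  refine ⟨(16 * (1 + T + A + B))⁻¹, inv_pos.2 hS, ?_⟩
  intro φ hφ hφT hφ1 hφ2 s₁ s₂ hs
  set c := (16 * (1 + T + A + B))⁻¹ with hcdef
  have hc0 : 0 < c := inv_pos.2 hS
  have hcS : c * (16 * (1 + T + A + B)) = 1 := inv_mul_cancel₀ hS.ne'
  have hcT : 0 < c * T := mul_pos hc0 hT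
  have hcA : 0 ≤ c * A := by positivity
  have hcB : 0 ≤ c * B := by positivity
  have hc1 : c ≤ 1 := by linarith
  have hδ : ∀ t x, |deriv (deriv φ) t * (ξ x * deriv η x - η x * deriv ξ x)| +
      |deriv φ t ^ 2 * (ξ x * deriv ξ x + η x * deriv η x)| ≤ 1 / 16 := fun t x => by
    have h1 : |deriv (deriv φ) t * (ξ x * deriv η x - η x * deriv ξ x)| ≤ c * A := by
      rw [abs_mul]; exact mul_le_mul (hφ2 t).le (hA x) (abs_nonneg _) hc0.le
    have h2 : |deriv φ t ^ 2 * (ξ x * deriv ξ x + η x * deriv η x)| ≤ c * B := by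
      rw [abs_mul]
      refine mul_le_mul ?_ (hB x) (abs_nonneg _) hc0.le
      rw [abs_pow]
      nlinarith [hφ1 t, abs_nonneg (deriv φ t)]
    linarith
  have hφ0 : ∀ t, |φ t - φ 0| ≤ 1 / 16 := fun t =>
    (hφT.abs_sub_le_mul_of_abs_deriv_le hT (hφ.differentiable (by simp))
      (fun r => (hφ1 r).le) t).trans (by linarith)
  obtain ⟨a', a, b, b', haa, hab, hbb, hs₁, hs₂, hVa, hVb⟩ := exists_barrier_points hcurve hφ0 hs
  obtain ⟨ε, hε0, hε⟩ : ∃ ε : ℝ, 0 < ε ∧ ε ≤ 1 / 16 ∧ ε ≤ a - a' ∧ ε ≤ b' - b ∧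
      ε ≤ (b - a) / 2 := by
    refine ⟨min (min (1 / 16) (a - a')) (min (b' - b) ((b - a) / 2)), ?_, ?_, ?_, ?_, ?_⟩
    · exact lt_min (lt_min (by norm_num) (by linarith)) (lt_min (by linarith) (by linarith))
    · exact (min_le_left _ _).trans (min_le_left _ _)
    · exact (min_le_left _ _).trans (min_le_right _ _)
    · exact (min_le_right _ _).trans (min_le_left _ _)
    · exact (min_le_right _ _).trans (min_le_right _ _)
  obtain ⟨hε1, hεa, hεb, hεab⟩ := hε
  obtain ⟨lam₀, hlam₀⟩ := eventually_atTop.1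
    ((exists_approximate_equilibrium hcurve hT hg hgT hg0 hφ hφT hδ a hε0).and
      (exists_approximate_equilibrium hcurve hT hg hgT hg0 hφ hφT hδ b hε0))
  refine ⟨lam₀, fun lam hlam => ?_⟩
  obtain ⟨⟨α, hα, hαT, hαa, hα2⟩, β, hβ, hβT, hβb, hβ2⟩ := hlam₀ lam hlam
  obtain ⟨s, hsol, hsT, hsb⟩ := exists_periodic_tangentialForce_solution hcurve hT hg hgT hφ hφT
    hα hαT (fun t => by linarith [(abs_le.1 (hα2 t)).1, hVa t])
    hβ hβT (fun t => by linarith [(abs_le.1 (hβ2 t)).2, hVb t])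
    (fun t => by linarith [(abs_lt.1 (hαa t)).2, (abs_lt.1 (hβb t)).1])
  refine ⟨s, hsol, hsT, fun t => ⟨?_, ?_⟩⟩
  · linarith [hs₁ t, (abs_lt.1 (hαa t)).1, (hsb t).1]
  · linarith [hs₂ t, (abs_lt.1 (hβb t)).2, (hsb t).2]
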